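/- Let $T$ be a first-order theory and $\varphi(x,y)$ a formula ($x,y$ tuples of variables). Parameters are always taken from a model $M\models T$, and a set of formulas over $M$ is consistent if it is finitely satisfiable in $M$ (equivalently, consistent with the elementary diagram of $M$). A family of formulas $(\varphi(x,b_i) : i\in I)$ is $2$-inconsistent if $\varphi(x,b_i)\wedge\varphi(x,b_j)$ is inconsistent for all indices $i\ne j$ in $I$. Cographs are the members of the smallest isomorphism-closed class of graphs containing the one-vertex graph and closed under disjoint unions and graph joins. $T$ admits arbitrary cograph consistency-inconsistency patterns for $\varphi$ if for every cograph $(V,E)$ there is a family $(b_v : v\in V)$ of parameters (tuples of the sort of $y$ in a model of $T$) such that for every $V_0\subseteq V$, $\{\varphi(x,b_v) : v\in V_0\}$ is consistent if and only if $V_0$ is an anticlique (independent set). Let $L=\omega$ or $L=d<\omega$ and write $2^2=\{0,1\}\times\{0,1\}$. For $A,B\subseteq(2^2)^L$, say that, for some $\ell\in L$ and some $\tau:\{p\in L: p<\ell\}\to 2^2$, - $A$ is narrowly below $B$ if for some $i<2$ all elements of $A$ extend $\tau^\frown(i,0)$ and all elements of $B$ extend $\tau^\frown(i,1)$; - $A$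 is narrowly to the left of $B$ if for some $j<2$ all elements of $A$ extend $\tau^\frown(0,j)$ and all elements of $B$ extend $\tau^\frown(1,j)$; - $A$ is widely to the left of $B$ if every element of $A$ extends $\tau^\frown(0,0)$ or $\tau^\frown(0,1)$, and every element of $B$ extends $\tau^\frown(1,0)$ or $\tau^\frown(1,1)$. For $n\le\omega$, the finite up-$n$-combs (resp. right-$n$-combs, wide right-$n$-combs) form the smallest class of subsets of $(2^2)^L$ that contains the singletons and contains $A\cup B$ whenever $A,B$ are in the class, $|A|\le n$, and $A$ is narrowly below (resp. narrowly to the left of, widely to the left of) $B$. For $m,n\le\omega$, a $(2,m,n)$-weave for $\varphi$ of depth $L$ is a family $(b_\sigma:\sigma\in(2^2)^L)$ of parameters of the sort of $y$ in a model of $T$ such that the family $(\varphi(x,b_\sigma):\sigma\in C)$ is $2$-inconsistent for every finite up-$m$-comb $C$ and consistent for every finite right-$n$-comb $C$; it is strong if this family is moreover consistent for every finite wide right-$n$-comb $C$. Then the following are equivalent, where in each of (2)-(5) the versions with and without the word "strong" are all equivalent as well: 1. $T$ admits arbitrary cograph consistency-inconsistency patterns for $\varphi$; 2. $T$ has a (strong)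 $(2,\omega,\omega)$-weave for $\varphi$ of depth $\omega$; 3. $T$ has a (strong) $(2,1,\omega)$-weave for $\varphi$ of depth $\omega$; 4. for every $d<\omega$, $T$ has a (strong) $(2,\omega,\omega)$-weave for $\varphi$ of depth $d$; 5. for every $d<\omega$, $T$ has a (strong) $(2,1,\omega)$-weave for $\varphi$ of depth $d$. -/

import Mathlib

universe u v

namespace Weave

open FirstOrder FirstOrder.Language

section Combs

/-- The set `2²` of pairs `(i, j)` with `i, j < 2`. -/
abbrev Two2 : Type := Fin 2 × Fin 2

variable {L : Type*} [LinearOrder L]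

/-- For `τ : (2²)^{<L}` (a function on the topped initial segment `{p | p < ℓ}`) and `a : 2²`,
the sequence `σ : (2²)^L` extends `τ ⌢ a`. -/
def Extends (σ : L → Two2) (ℓ : L) (τ : Set.Iio ℓ → Two2) (a : Two2) : Prop :=
  (∀ p : Set.Iio ℓ, σ p = τ p) ∧ σ ℓ = a

/-- `A` is narrowly below `B`. -/
def NarrowlyBelow (A B : Set (L → Two2)) : Prop :=
  ∃ (ℓ : L) (τ : Set.Iio ℓ → Two2) (i : Fin 2),
    (∀ σ ∈ A, Extends σ ℓ τ (i, 0)) ∧ (∀ σ ∈ B, Extends σ ℓ τ (i, 1))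

/-- `A` is narrowly to the left of `B`. -/
def NarrowlyLeft (A B : Set (L → Two2)) : Prop :=
  ∃ (ℓ : L) (τ : Set.Iio ℓ → Two2) (j : Fin 2),
    (∀ σ ∈ A, Extends σ ℓ τ (0, j)) ∧ (∀ σ ∈ B, Extends σ ℓ τ (1, j))

/-- `A` is widely to the left of `B`. -/
def WidelyLeft (A B : Set (L → Two2)) : Prop :=
  ∃ (ℓ : L) (τ : Set.Iio ℓ → Two2),
    (∀ σ ∈ A, Extends σ ℓ τ (0, 0) ∨ Extends σ ℓ τ (0, 1)) ∧
    (∀ σ ∈ B, Extends σ ℓ τ (1, 0) ∨ Extends σ ℓ τ (1, 1))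

/-- Finite up-`n`-combs, for `n ≤ ω` (`ω` is `⊤ : ℕ∞`). -/
inductive IsUpComb (n : ℕ∞) : Set (L → Two2) → Prop
  | singleton (σ : L → Two2) : IsUpComb n {σ}
  | union {A B : Set (L → Two2)} : IsUpComb n A → IsUpComb n B → A.encard ≤ n →
      NarrowlyBelow A B → IsUpComb n (A ∪ B)

/-- Finite right-`n`-combs, for `n ≤ ω`. -/
inductive IsRightComb (n : ℕ∞) : Set (L → Two2) → Prop
  | singleton (σ : L → Two2) : IsRightComb n {σ}
  | union {A B : Set (L → Two2)} : IsRightComb n A → IsRightComb n B → A.encard ≤ n →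
      NarrowlyLeft A B → IsRightComb n (A ∪ B)

/-- Finite wide right-`n`-combs, for `n ≤ ω`. -/
inductive IsWideRightComb (n : ℕ∞) : Set (L → Two2) → Prop
  | singleton (σ : L → Two2) : IsWideRightComb n {σ}
  | union {A B : Set (L → Two2)} : IsWideRightComb n A → IsWideRightComb n B → A.encard ≤ n →
      WidelyLeft A B → IsWideRightComb n (A ∪ B)

end Combs

section Consistency

variable {ℒ : FirstOrder.Language.{u, v}} {α β ι : Type*} {M : Type*} [ℒ.Structure M]

/-- For a family `b` of parameters (tuples of sort `y = β`) in `M`, the set of formulas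
`{φ(x, b i) : i ∈ S}` is consistent: it is finitely satisfiable in `M`, i.e. consistent with the
elementary diagram of `M`. -/
def Consistent (φ : ℒ.Formula (α ⊕ β)) (b : ι → β → M) (S : Set ι) : Prop :=
  ∀ F : Finset ι, (F : Set ι) ⊆ S → ∃ a : α → M, ∀ i ∈ F, φ.Realize (Sum.elim a (b i))

/-- The family `(φ(x, b i) : i ∈ S)` is `k`-inconsistent: for any `k` distinct indices in `S`,
the corresponding formulas are jointly inconsistent. -/
def KInconsistent (k : ℕ) (φ : ℒ.Formula (α ⊕ β)) (b : ι → β → M) (S : Set ι) : Prop :=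
  ∀ F : Finset ι, (F : Set ι) ⊆ S → F.card = k → ¬ Consistent φ b (F : Set ι)

/-- `b` is a `(k, m, n)`-weave for `φ(x, y)` of depth `L`, with parameters in `M`. -/
structure IsWeave (k : ℕ) (m n : ℕ∞) (L : Type*) [LinearOrder L]
    (φ : ℒ.Formula (α ⊕ β)) (b : (L → Two2) → β → M) : Prop where
  inconsistent : ∀ C : Set (L → Two2), IsUpComb m C → KInconsistent k φ b C
  consistent : ∀ C : Set (L → Two2), IsRightComb n C → Consistent φ b C

/-- `b` is a strong `(k, m, n)`-weave for `φ(x, y)` of depth `L`, with parameters in `M`. -/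
structure IsStrongWeave (k : ℕ) (m n : ℕ∞) (L : Type*) [LinearOrder L]
    (φ : ℒ.Formula (α ⊕ β)) (b : (L → Two2) → β → M) : Prop
    extends IsWeave k m n L φ b where
  wide_consistent : ∀ C : Set (L → Two2), IsWideRightComb n C → Consistent φ b C

end Consistency

section Theories

variable {ℒ : FirstOrder.Language.{u, v}} {α β : Type*}

/-- `T` has a `(k, m, n)`-weave for `φ(x, y)` of depth `L` (in some model of `T`). -/
def HasWeave (T : ℒ.Theory) (φ : ℒ.Formula (α ⊕ β)) (k : ℕ) (m n : ℕ∞)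
    (L : Type*) [LinearOrder L] : Prop :=
  ∃ (M : Theory.ModelType.{u, v, max u v} T) (b : (L → Two2) → β → M), IsWeave k m n L φ b

/-- `T` has a strong `(k, m, n)`-weave for `φ(x, y)` of depth `L` (in some model of `T`). -/
def HasStrongWeave (T : ℒ.Theory) (φ : ℒ.Formula (α ⊕ β)) (k : ℕ) (m n : ℕ∞)
    (L : Type*) [LinearOrder L] : Prop :=
  ∃ (M : Theory.ModelType.{u, v, max u v} T) (b : (L → Two2) → β → M),
    IsStrongWeave k m n L φ b

/-- The graph join of `G` and `H`. -/
def graphJoin {V W : Type*} (G : SimpleGraph V) (H : SimpleGraph W) : SimpleGraph (V ⊕ W) :=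
  SimpleGraph.sum G H ⊔ completeBipartiteGraph V W

/-- Cographs: the smallest (isomorphism-closed) class of graphs containing the one-vertex graph
and closed under coproducts (disjoint sums) and graph joins. -/
inductive IsCograph : {V : Type} → SimpleGraph V → Prop
  | singleton : IsCograph (⊥ : SimpleGraph Unit)
  | coproduct {V W : Type} {G : SimpleGraph V} {H : SimpleGraph W} :
      IsCograph G → IsCograph H → IsCograph (SimpleGraph.sum G H)
  | join {V W : Type} {G : SimpleGraph V} {H : SimpleGraph W} :
      IsCograph G → IsCograph H → IsCograph (graphJoin G H)
  | iso {V W : Type} {G : SimpleGraph V} {H : SimpleGraph W} :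
      Nonempty (G ≃g H) → IsCograph G → IsCograph H

/-- `T` admits arbitrary cograph consistency-inconsistency patterns for `φ(x, y)`. -/
def AdmitsCographPatterns (T : ℒ.Theory) (φ : ℒ.Formula (α ⊕ β)) : Prop :=
  ∀ (V : Type) (G : SimpleGraph V), IsCograph G →
    ∃ (M : Theory.ModelType.{u, v, max u v} T) (b : V → β → M),
      ∀ V₀ : Set V, Consistent φ b V₀ ↔ G.IsIndepSet V₀

end Theories

end Weave

namespace Weave

open FirstOrder FirstOrder.Language

/-! ### Combs as cliques and anticliques of a cograph on `(2²)^L`. -/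

section Combinatorics

variable {L : Type*} [LinearOrder L]

/-! Weaves and cograph patterns encode the same data. On `(2²)^L`, join two sequences when they
first differ at a place where only the second coordinate changes. Up-combs are then cliques and wide
right-combs are anticliques. For `L = d` this graph is a cograph (`isCograph_weaveGraph`), so a
pattern for it is a strong weave of depth `d`.

Conversely, every cograph maps into `(2²)^ω` with edges going to narrowly comparable pairs and
nonempty anticliques to right-combs (`IsCograph.exists_isCombEmbedding`). Pulling a depth-`ω` weave
back along this map gives the pattern. Only two-element up-combs are used, so `m = 1` suffices.

All finite depths yield depth `ω` by an ultraproduct over a nonprincipal ultrafilter, with `b_σ` the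
class of the parameters at `σ` truncated to length `d` (`isWeave_ultraParam`). A finite comb splits
at finitely many levels, so its truncations are combs of the same kind for all large `d`. -/

theorem IsUpComb.mono {m n : ℕ∞} (h : m ≤ n) {C : Set (L → Two2)} (hC : IsUpComb m C) :
    IsUpComb n C := by
  induction hC with
  | singleton σ => exact .singleton σ
  | union _ _ hn hAB ihA ihB => exact .union ihA ihB (hn.trans h) hAB

theorem NarrowlyLeft.widelyLeft {A B : Set (L → Two2)} (h : NarrowlyLeft A B) :
    WidelyLeft A B := by
  obtain ⟨ℓ, τ, j, hA, hB⟩ := h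
  refine ⟨ℓ, τ, fun σ hσ => ?_, fun σ hσ => ?_⟩ <;> fin_cases j
  exacts [.inl (hA σ hσ), .inr (hA σ hσ), .inl (hB σ hσ), .inr (hB σ hσ)]

theorem IsRightComb.isWideRightComb {n : ℕ∞} {C : Set (L → Two2)} (hC : IsRightComb n C) :
    IsWideRightComb n C := by
  induction hC with
  | singleton σ => exact .singleton σ
  | union _ _ hn hAB ihA ihB => exact .union ihA ihB hn hAB.widelyLeft

/-- The graph on `(2²)^L` in which `σ` and `τ` are adjacent when they first differ at a place
where their first coordinates agree. -/
def weaveGraph (L : Type*) [LinearOrder L] : SimpleGraph (L → Two2) where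
  Adj σ τ := ∃ ℓ, (∀ p < ℓ, σ p = τ p) ∧ (σ ℓ).1 = (τ ℓ).1 ∧ (σ ℓ).2 ≠ (τ ℓ).2
  symm.symm := fun _ _ ⟨ℓ, h, h₁, h₂⟩ => ⟨ℓ, fun p hp => (h p hp).symm, h₁.symm, h₂.symm⟩
  loopless.irrefl := fun _ ⟨_, _, _, h⟩ => h rfl

/-- The place of first difference is unique, so the coordinates there decide adjacency. -/
theorem not_weaveGraph_adj {σ τ : L → Two2} {ℓ : L} (h : ∀ p < ℓ, σ p = τ p)
    (h₁ : (σ ℓ).1 ≠ (τ ℓ).1) : ¬ (weaveGraph L).Adj σ τ := by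
  rintro ⟨k, hk, hk₁, hk₂⟩
  rcases lt_trichotomy k ℓ with hlt | rfl | hlt
  · exact hk₂ (congrArg Prod.snd (h k hlt))
  · exact h₁ hk₁
  · exact h₁ (congrArg Prod.fst (hk ℓ hlt))

theorem Extends.eq_of_lt {σ σ' : L → Two2} {ℓ : L} {τ : Set.Iio ℓ → Two2} {a a' : Two2}
    (h : Extends σ ℓ τ a) (h' : Extends σ' ℓ τ a') (p : L) (hp : p < ℓ) : σ p = σ' p :=
  (h.1 ⟨p, hp⟩).trans (h'.1 ⟨p, hp⟩).symm

theorem IsUpComb.isClique {n : ℕ∞} {C : Set (L → Two2)} (hC : IsUpComb n C) :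
    (weaveGraph L).IsClique C := by
  induction hC with
  | singleton σ => exact SimpleGraph.isClique_singleton σ
  | @union A B _ _ _ hAB ihA ihB =>
    obtain ⟨ℓ, τ, i, hA, hB⟩ := hAB
    have key : ∀ σ ∈ A, ∀ σ' ∈ B, (weaveGraph L).Adj σ σ' := fun σ hσ σ' hσ' =>
      ⟨ℓ, (hA σ hσ).eq_of_lt (hB σ' hσ'), by rw [(hA σ hσ).2, (hB σ' hσ').2],
        by rw [(hA σ hσ).2, (hB σ' hσ').2]; simp⟩
    rintro x (hx | hx) y (hy | hy) hxy
    exacts [ihA hx hy hxy, key x hx y hy, (key y hy x hx).symm, ihB hx hy hxy]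

theorem NarrowlyBelow.ne {σ τ : L → Two2} (h : NarrowlyBelow {σ} {τ}) : σ ≠ τ := by
  obtain ⟨ℓ, ρ, i, hσ, hτ⟩ := h
  rintro rfl
  simpa using (hσ σ rfl).2.symm.trans (hτ σ rfl).2

theorem IsWideRightComb.isIndepSet {n : ℕ∞} {C : Set (L → Two2)} (hC : IsWideRightComb n C) :
    (weaveGraph L).IsIndepSet C := by
  induction hC with
  | singleton σ => exact Set.pairwise_singleton σ _
  | @union A B _ _ _ hAB ihA ihB =>
    obtain ⟨ℓ, τ, hA, hB⟩ := hAB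
    have key : ∀ σ ∈ A, ∀ σ' ∈ B, ¬ (weaveGraph L).Adj σ σ' := by
      intro σ hσ σ' hσ'
      rcases hA σ hσ with h | h <;> rcases hB σ' hσ' with h' | h' <;>
        exact not_weaveGraph_adj (h.eq_of_lt h') (by rw [h.2, h'.2]; simp)
    rintro x (hx | hx) y (hy | hy) hxy
    exacts [ihA hx hy hxy, key x hx y hy, fun h => key y hy x hx h.symm, ihB hx hy hxy]

theorem weaveGraph_cons_adj {d : ℕ} {a b : Two2} {σ τ : Fin d → Two2} :
    (weaveGraph (Fin (d + 1))).Adj (Fin.cons a σ) (Fin.cons b τ) ↔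
      a = b ∧ (weaveGraph (Fin d)).Adj σ τ ∨ a.1 = b.1 ∧ a.2 ≠ b.2 := by
  constructor
  · rintro ⟨ℓ, h, h₁, h₂⟩
    induction ℓ using Fin.cases with
    | zero => exact .inr ⟨by simpa using h₁, by simpa using h₂⟩
    | succ ℓ =>
      refine .inl ⟨by simpa using h 0 (Fin.succ_pos ℓ), ℓ, fun p hp => ?_,
        by simpa using h₁, by simpa using h₂⟩
      simpa using h p.succ (Fin.succ_lt_succ_iff.2 hp)
  · rintro (⟨rfl, ℓ, h, h₁, h₂⟩ | h)
    · refine ⟨ℓ.succ, fun p hp => ?_, by simpa using h₁, by simpa using h₂⟩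
      induction p using Fin.cases with
      | zero => simp
      | succ p => simpa using h p (Fin.succ_lt_succ_iff.1 hp)
    · exact ⟨0, fun p hp => absurd hp (Fin.not_lt_zero p), by simpa using h.1, by simpa using h.2⟩

/-- Sequences of length `d + 1` sorted by their first entry. -/
def splitFirst (d : ℕ) : ((Fin d → Two2) ⊕ (Fin d → Two2)) ⊕ ((Fin d → Two2) ⊕ (Fin d → Two2)) →
    (Fin (d + 1) → Two2) :=
  Sum.elim (Sum.elim (fun σ => Fin.cons (0, 0) σ) (fun σ => Fin.cons (0, 1) σ))
    (Sum.elim (fun σ => Fin.cons (1, 0) σ) (fun σ => Fin.cons (1, 1) σ))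

theorem splitFirst_bijective (d : ℕ) : Function.Bijective (splitFirst d) := by
  constructor
  · rintro ((σ | σ) | (σ | σ)) ((τ | τ) | (τ | τ)) h <;> simp [splitFirst, Fin.cons_inj] at h ⊢ <;>
      exact h
  · intro σ
    obtain ⟨a, τ, rfl⟩ : ∃ (a : Two2) (τ : Fin d → Two2), Fin.cons a τ = σ :=
      ⟨σ 0, Fin.tail σ, Fin.cons_self_tail σ⟩
    obtain ⟨i, j⟩ := a
    fin_cases i <;> fin_cases j
    exacts [⟨.inl (.inl τ), rfl⟩, ⟨.inl (.inr τ), rfl⟩, ⟨.inr (.inl τ), rfl⟩, ⟨.inr (.inr τ), rfl⟩]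

/-- Sorting by the first entry splits depth `d + 1` into four copies of depth `d`: copies with equal
first coordinate are joined, and the two resulting joins are disjoint. -/
theorem isCograph_weaveGraph (d : ℕ) : IsCograph (weaveGraph (Fin d)) := by
  induction d with
  | zero =>
    refine .iso ⟨⟨Equiv.ofUnique Unit (Fin 0 → Two2), ?_⟩⟩ .singleton
    intro a b
    simp [weaveGraph]
  | succ d ih =>
    refine .iso ⟨⟨Equiv.ofBijective _ (splitFirst_bijective d), ?_⟩⟩
      (.coproduct (.join ih ih) (.join ih ih))
    rintro ((σ | σ) | (σ | σ)) ((τ | τ) | (τ | τ)) <;>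
      simp [splitFirst, weaveGraph_cons_adj, graphJoin]

/-! ### Placing cographs inside `(2²)^ω`. -/

/-- The sequence with first entry `a` followed by `σ`. -/
def consSeq (a : Two2) (σ : ℕ → Two2) : ℕ → Two2
  | 0 => a
  | n + 1 => σ n

theorem Extends.consSeq {σ : ℕ → Two2} {ℓ : ℕ} {τ : Set.Iio ℓ → Two2} {b : Two2}
    (h : Extends σ ℓ τ b) (a : Two2) :
    Extends (consSeq a σ) (ℓ + 1)
      -- `consSeq` needs a total sequence, so `τ` is padded by `a` from `ℓ` on; the padding is never
      -- read.
      (fun p => Weave.consSeq a (fun q => if hq : q < ℓ then τ ⟨q, hq⟩ else a) p) b := by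
  refine ⟨?_, h.2⟩
  rintro ⟨_ | p, hp⟩
  · rfl
  · have hp' : p < ℓ := Nat.succ_lt_succ_iff.1 hp
    simpa [Weave.consSeq, hp'] using h.1 ⟨p, hp'⟩

theorem extends_zero_consSeq (a : Two2) (σ : ℕ → Two2) (τ : Set.Iio 0 → Two2) :
    Extends (consSeq a σ) 0 τ a :=
  ⟨fun p => absurd p.2 (Nat.not_lt_zero _), rfl⟩

theorem NarrowlyBelow.image_consSeq {A B : Set (ℕ → Two2)} (h : NarrowlyBelow A B) (a : Two2) :
    NarrowlyBelow (consSeq a '' A) (consSeq a '' B) := by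
  obtain ⟨ℓ, τ, i, hA, hB⟩ := h
  exact ⟨ℓ + 1, _, i, Set.forall_mem_image.2 fun σ hσ => (hA σ hσ).consSeq a,
    Set.forall_mem_image.2 fun σ hσ => (hB σ hσ).consSeq a⟩

theorem NarrowlyLeft.image_consSeq {A B : Set (ℕ → Two2)} (h : NarrowlyLeft A B) (a : Two2) :
    NarrowlyLeft (consSeq a '' A) (consSeq a '' B) := by
  obtain ⟨ℓ, τ, i, hA, hB⟩ := h
  exact ⟨ℓ + 1, _, i, Set.forall_mem_image.2 fun σ hσ => (hA σ hσ).consSeq a,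
    Set.forall_mem_image.2 fun σ hσ => (hB σ hσ).consSeq a⟩

theorem IsRightComb.image_consSeq {n : ℕ∞} {C : Set (ℕ → Two2)} (hC : IsRightComb n C)
    (a : Two2) : IsRightComb n (consSeq a '' C) := by
  induction hC with
  | singleton σ => rw [Set.image_singleton]; exact .singleton _
  | union _ _ hn hAB ihA ihB =>
    rw [Set.image_union]
    exact .union ihA ihB ((Set.encard_image_le _ _).trans hn) (hAB.image_consSeq a)

/-- `f` sends edges to pairs that are narrowly comparable, and nonempty anticliques to finite
right-`ω`-combs. -/
structure IsCombEmbedding {V : Type*} (G : SimpleGraph V) (f : V → ℕ → Two2) : Prop where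
  adj : ∀ v w, G.Adj v w → NarrowlyBelow {f v} {f w} ∨ NarrowlyBelow {f w} {f v}
  indep : ∀ S : Set V, S.Nonempty → G.IsIndepSet S → IsRightComb ⊤ (f '' S)

theorem IsCombEmbedding.consSeq {V : Type*} {G : SimpleGraph V} {f : V → ℕ → Two2}
    (h : IsCombEmbedding G f) (a : Two2) : IsCombEmbedding G (fun v => consSeq a (f v)) where
  adj v w hvw := by
    simpa only [Set.image_singleton] using
      (h.adj v w hvw).imp (·.image_consSeq a) (·.image_consSeq a)
  indep S hS hi := by
    rw [← Set.image_image]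
    exact (h.indep S hS hi).image_consSeq a

/-- First entries `(0, 0)` and `(1, 0)` put one image narrowly to the left of the other, so
anticliques of the two parts unite to a right-comb. -/
theorem IsCombEmbedding.coproduct {V W : Type*} {G : SimpleGraph V} {H : SimpleGraph W}
    {f : V → ℕ → Two2} {g : W → ℕ → Two2} (hf : IsCombEmbedding G f) (hg : IsCombEmbedding H g) :
    IsCombEmbedding (SimpleGraph.sum G H)
      (Sum.elim (fun v => Weave.consSeq (0, 0) (f v)) (fun w => Weave.consSeq (1, 0) (g w))) where
  adj := by
    rintro (v | v) (w | w) h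
    · exact (hf.consSeq (0, 0)).adj v w (by simpa using h)
    · simp at h
    · simp at h
    · exact (hg.consSeq (1, 0)).adj v w (by simpa using h)
  indep S hS hi := by
    obtain ⟨A, hA⟩ : ∃ A, A = Sum.inl ⁻¹' S := ⟨_, rfl⟩
    obtain ⟨B, hB⟩ : ∃ B, B = Sum.inr ⁻¹' S := ⟨_, rfl⟩
    have hS' : S = Sum.inl '' A ∪ Sum.inr '' B := by
      rw [hA, hB, Set.image_preimage_inl_union_image_preimage_inr]
    have iA : G.IsIndepSet A := fun x hx y hy hxy hadj =>
      hi (show Sum.inl x ∈ S by rwa [hA] at hx) (show Sum.inl y ∈ S by rwa [hA] at hy)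
        (by simpa using hxy) (by simpa using hadj)
    have iB : H.IsIndepSet B := fun x hx y hy hxy hadj =>
      hi (show Sum.inr x ∈ S by rwa [hB] at hx) (show Sum.inr y ∈ S by rwa [hB] at hy)
        (by simpa using hxy) (by simpa using hadj)
    rw [hS', Set.image_union, Set.image_image, Set.image_image]
    simp only [Sum.elim_inl, Sum.elim_inr]
    -- Combs are nonempty, so an anticlique contained in one part cannot be treated as a union.
    rcases A.eq_empty_or_nonempty with rfl | nA
    · rcases B.eq_empty_or_nonempty with rfl | nB
      · simp [hS'] at hS
      · simpa using (hg.consSeq (1, 0)).indep B nB iB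
    · rcases B.eq_empty_or_nonempty with rfl | nB
      · simpa using (hf.consSeq (0, 0)).indep A nA iA
      · exact .union ((hf.consSeq (0, 0)).indep A nA iA) ((hg.consSeq (1, 0)).indep B nB iB) le_top
          ⟨0, fun _ => 0, 0, Set.forall_mem_image.2 fun _ _ => extends_zero_consSeq _ _ _,
            Set.forall_mem_image.2 fun _ _ => extends_zero_consSeq _ _ _⟩

/-- First entries `(0, 0)` and `(0, 1)` make every cross pair narrowly comparable. An anticlique of
a join lies in one side, so no union of combs is needed. -/
theorem IsCombEmbedding.join {V W : Type*} {G : SimpleGraph V} {H : SimpleGraph W}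
    {f : V → ℕ → Two2} {g : W → ℕ → Two2} (hf : IsCombEmbedding G f) (hg : IsCombEmbedding H g) :
    IsCombEmbedding (graphJoin G H)
      (Sum.elim (fun v => Weave.consSeq (0, 0) (f v)) (fun w => Weave.consSeq (0, 1) (g w))) where
  adj := by
    have key : ∀ v w, NarrowlyBelow {Weave.consSeq (0, 0) (f v)} {Weave.consSeq (0, 1) (g w)} :=
      fun v w => ⟨0, fun _ => 0, 0, by simpa using extends_zero_consSeq _ _ _,
        by simpa using extends_zero_consSeq _ _ _⟩
    rintro (v | v) (w | w) h
    · exact (hf.consSeq (0, 0)).adj v w (by simpa [graphJoin] using h)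
    · exact .inl (key v w)
    · exact .inr (key w v)
    · exact (hg.consSeq (0, 1)).adj v w (by simpa [graphJoin] using h)
  indep S hS hi := by
    obtain ⟨v | w, hx⟩ := hS
    · have hS' : S = Sum.inl '' (Sum.inl ⁻¹' S) := by
        refine (Set.image_preimage_eq_of_subset ?_).symm
        rintro (y | y) hy
        · exact ⟨y, rfl⟩
        · exact absurd (by simp [graphJoin]) (hi hx hy (by simp))
      rw [hS', Set.image_image]
      refine (hf.consSeq (0, 0)).indep _ ⟨v, hx⟩ fun y hy z hz hyz hadj => ?_
      exact hi hy hz (by simpa using hyz) (by simpa [graphJoin] using hadj)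
    · have hS' : S = Sum.inr '' (Sum.inr ⁻¹' S) := by
        refine (Set.image_preimage_eq_of_subset ?_).symm
        rintro (y | y) hy
        · exact absurd (by simp [graphJoin]) (hi hx hy (by simp))
        · exact ⟨y, rfl⟩
      rw [hS', Set.image_image]
      refine (hg.consSeq (0, 1)).indep _ ⟨w, hx⟩ fun y hy z hz hyz hadj => ?_
      exact hi hy hz (by simpa using hyz) (by simpa [graphJoin] using hadj)

theorem IsCograph.exists_isCombEmbedding {V : Type} {G : SimpleGraph V} (hG : IsCograph G) :
    ∃ f : V → ℕ → Two2, IsCombEmbedding G f := by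
  induction hG with
  | singleton =>
    refine ⟨fun _ _ => 0, by simp, fun S hS _ => ?_⟩
    rw [Set.Nonempty.image_const hS]
    exact .singleton _
  | coproduct _ _ ihG ihH =>
    obtain ⟨f, hf⟩ := ihG
    obtain ⟨g, hg⟩ := ihH
    exact ⟨_, hf.coproduct hg⟩
  | join _ _ ihG ihH =>
    obtain ⟨f, hf⟩ := ihG
    obtain ⟨g, hg⟩ := ihH
    exact ⟨_, hf.join hg⟩
  | iso e _ ih =>
    obtain ⟨e⟩ := e
    obtain ⟨f, hf⟩ := ih
    refine ⟨fun w => f (e.symm w), fun v w h => hf.adj _ _ (e.symm.map_adj_iff.2 h),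
      fun S hS hi => ?_⟩
    rw [← Set.image_image f]
    refine hf.indep _ (hS.image _) ?_
    rintro _ ⟨x, hx, rfl⟩ _ ⟨y, hy, rfl⟩ hxy hadj
    exact hi hx hy (fun h => hxy (by rw [h])) (e.symm.map_adj_iff.1 hadj)

/-! ### Truncating combs to finite depth. -/

/-- The initial segment of length `d` of a sequence. -/
def truncate (d : ℕ) (σ : ℕ → Two2) : Fin d → Two2 := fun p => σ p

theorem Extends.truncate {σ : ℕ → Two2} {ℓ : ℕ} {τ : Set.Iio ℓ → Two2} {a : Two2}
    (h : Extends σ ℓ τ a) {d : ℕ} (hd : ℓ < d) :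
    Extends (truncate d σ) (⟨ℓ, hd⟩ : Fin d) (fun p => τ ⟨p.1, p.2⟩) a :=
  ⟨fun p => h.1 ⟨p.1, p.2⟩, h.2⟩

open Filter

theorem NarrowlyBelow.eventually_truncate {A B : Set (ℕ → Two2)} (h : NarrowlyBelow A B) :
    ∀ᶠ d in atTop, NarrowlyBelow (truncate d '' A) (truncate d '' B) := by
  obtain ⟨ℓ, τ, i, hA, hB⟩ := h
  filter_upwards [eventually_gt_atTop ℓ] with d hd
  exact ⟨⟨ℓ, hd⟩, _, i, Set.forall_mem_image.2 fun σ hσ => (hA σ hσ).truncate hd,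
    Set.forall_mem_image.2 fun σ hσ => (hB σ hσ).truncate hd⟩

theorem NarrowlyLeft.eventually_truncate {A B : Set (ℕ → Two2)} (h : NarrowlyLeft A B) :
    ∀ᶠ d in atTop, NarrowlyLeft (truncate d '' A) (truncate d '' B) := by
  obtain ⟨ℓ, τ, i, hA, hB⟩ := h
  filter_upwards [eventually_gt_atTop ℓ] with d hd
  exact ⟨⟨ℓ, hd⟩, _, i, Set.forall_mem_image.2 fun σ hσ => (hA σ hσ).truncate hd,
    Set.forall_mem_image.2 fun σ hσ => (hB σ hσ).truncate hd⟩

theorem WidelyLeft.eventually_truncate {A B : Set (ℕ → Two2)} (h : WidelyLeft A B) :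
    ∀ᶠ d in atTop, WidelyLeft (truncate d '' A) (truncate d '' B) := by
  obtain ⟨ℓ, τ, hA, hB⟩ := h
  filter_upwards [eventually_gt_atTop ℓ] with d hd
  exact ⟨⟨ℓ, hd⟩, fun p => τ ⟨p.1, p.2⟩,
    Set.forall_mem_image.2 fun σ hσ => (hA σ hσ).imp (·.truncate hd) (·.truncate hd),
    Set.forall_mem_image.2 fun σ hσ => (hB σ hσ).imp (·.truncate hd) (·.truncate hd)⟩

theorem IsUpComb.eventually_truncate {n : ℕ∞} {C : Set (ℕ → Two2)} (hC : IsUpComb n C) :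
    ∀ᶠ d in atTop, IsUpComb n (truncate d '' C) := by
  induction hC with
  | singleton σ => exact .of_forall fun d => by rw [Set.image_singleton]; exact .singleton _
  | union _ _ hn hAB ihA ihB =>
    filter_upwards [ihA, ihB, hAB.eventually_truncate] with d h₁ h₂ h₃
    rw [Set.image_union]
    exact .union h₁ h₂ ((Set.encard_image_le _ _).trans hn) h₃

theorem IsRightComb.eventually_truncate {n : ℕ∞} {C : Set (ℕ → Two2)} (hC : IsRightComb n C) :
    ∀ᶠ d in atTop, IsRightComb n (truncate d '' C) := by
  induction hC with
  | singleton σ => exact .of_forall fun d => by rw [Set.image_singleton]; exact .singleton _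
  | union _ _ hn hAB ihA ihB =>
    filter_upwards [ihA, ihB, hAB.eventually_truncate] with d h₁ h₂ h₃
    rw [Set.image_union]
    exact .union h₁ h₂ ((Set.encard_image_le _ _).trans hn) h₃

theorem IsWideRightComb.eventually_truncate {n : ℕ∞} {C : Set (ℕ → Two2)}
    (hC : IsWideRightComb n C) : ∀ᶠ d in atTop, IsWideRightComb n (truncate d '' C) := by
  induction hC with
  | singleton σ => exact .of_forall fun d => by rw [Set.image_singleton]; exact .singleton _
  | union _ _ hn hAB ihA ihB =>
    filter_upwards [ihA, ihB, hAB.eventually_truncate] with d h₁ h₂ h₃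
    rw [Set.image_union]
    exact .union h₁ h₂ ((Set.encard_image_le _ _).trans hn) h₃

/-- Keeps `k` distinct indices distinct, so that `k`-inconsistency at finite depth applies to their
truncations. -/
theorem eventually_truncate_injOn (F : Finset (ℕ → Two2)) :
    ∀ᶠ d in atTop, Set.InjOn (truncate d) (F : Set (ℕ → Two2)) := by
  have key : ∀ x ∈ F, ∀ y ∈ F, ∀ᶠ d in atTop, truncate d x = truncate d y → x = y := by
    intro x _ y _
    by_cases hxy : x = y
    · exact .of_forall fun _ _ => hxy
    · obtain ⟨ℓ, hℓ⟩ := Function.ne_iff.1 hxy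
      filter_upwards [eventually_gt_atTop ℓ] with d hd h
      exact absurd (congrFun h ⟨ℓ, hd⟩) hℓ
  filter_upwards [(Finset.eventually_all F).2 fun x hx => (Finset.eventually_all F).2 (key x hx)]
    with d h x hx y hy
  exact h x hx y hy

end Combinatorics

/-! ### Weaves and cograph patterns in models. -/

section Models

variable {ℒ : FirstOrder.Language.{u, v}} {α β : Type*} {T : ℒ.Theory} {φ : ℒ.Formula (α ⊕ β)}

section Pairs

variable {ι : Type*} {M : Type*} [ℒ.Structure M]

theorem IsWeave.mono {k : ℕ} {m m' n : ℕ∞} (hm : m ≤ m') {L : Type*} [LinearOrder L]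
    {b : (L → Two2) → β → M} (h : IsWeave k m' n L φ b) : IsWeave k m n L φ b :=
  ⟨fun C hC => h.inconsistent C (hC.mono hm), h.consistent⟩

theorem IsStrongWeave.mono {k : ℕ} {m m' n : ℕ∞} (hm : m ≤ m') {L : Type*} [LinearOrder L]
    {b : (L → Two2) → β → M} (h : IsStrongWeave k m' n L φ b) : IsStrongWeave k m n L φ b :=
  ⟨h.toIsWeave.mono hm, h.wide_consistent⟩

theorem IsWeave.not_consistent_pair {m n : ℕ∞} (hm : 1 ≤ m) {L : Type*} [LinearOrder L]
    {b : (L → Two2) → β → M} (h : IsWeave 2 m n L φ b) {σ τ : L → Two2}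
    (hστ : NarrowlyBelow {σ} {τ}) : ¬ Consistent φ b {σ, τ} := by
  classical
  have hC : IsUpComb m ({σ} ∪ {τ}) :=
    .union (.singleton σ) (.singleton τ) (by simpa using hm) hστ
  have hne : σ ≠ τ := hστ.ne
  have := h.inconsistent _ hC {σ, τ} (by simp [Set.pair_comm])
    (Finset.card_pair hne)
  simpa using this

end Pairs

theorem HasWeave.mono {k : ℕ} {m m' n : ℕ∞} (hm : m ≤ m') {L : Type*} [LinearOrder L]
    (h : HasWeave T φ k m' n L) : HasWeave T φ k m n L :=
  let ⟨M, b, hb⟩ := h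
  ⟨M, b, hb.mono hm⟩

theorem HasStrongWeave.mono {k : ℕ} {m m' n : ℕ∞} (hm : m ≤ m') {L : Type*} [LinearOrder L]
    (h : HasStrongWeave T φ k m' n L) : HasStrongWeave T φ k m n L :=
  let ⟨M, b, hb⟩ := h
  ⟨M, b, hb.mono hm⟩

theorem HasStrongWeave.hasWeave {k : ℕ} {m n : ℕ∞} {L : Type*} [LinearOrder L]
    (h : HasStrongWeave T φ k m n L) : HasWeave T φ k m n L :=
  let ⟨M, b, hb⟩ := h
  ⟨M, b, hb.toIsWeave⟩

theorem AdmitsCographPatterns.hasStrongWeave (h : AdmitsCographPatterns T φ) (m n : ℕ∞) (d : ℕ) :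
    HasStrongWeave T φ 2 m n (Fin d) := by
  obtain ⟨M, b, hb⟩ := h _ _ (isCograph_weaveGraph d)
  refine ⟨M, b, ⟨fun C hC F hF hF2 hcons => ?_,
    fun C hC => (hb C).2 hC.isWideRightComb.isIndepSet⟩, fun C hC => (hb C).2 hC.isIndepSet⟩
  classical
  obtain ⟨σ, τ, hne, rfl⟩ := Finset.card_eq_two.1 hF2
  exact (hb _).1 hcons (by simp) (by simp) hne
    (hC.isClique (hF (by simp)) (hF (by simp)) hne)

theorem HasWeave.admitsCographPatterns {m : ℕ∞} (hm : 1 ≤ m) (h : HasWeave T φ 2 m ⊤ ℕ) :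
    AdmitsCographPatterns T φ := by
  intro V G hG
  obtain ⟨M, b, hb⟩ := h
  obtain ⟨f, hf⟩ := hG.exists_isCombEmbedding
  classical
  refine ⟨M, fun v => b (f v), fun V₀ => ⟨fun hcons x hx y hy _ hadj => ?_, fun hind F hF => ?_⟩⟩
  · obtain ⟨a, ha⟩ := hcons {x, y} (by simp [Set.insert_subset_iff, hx, hy])
    have hpair : ∀ S : Set (ℕ → Two2), S ⊆ {f x, f y} → Consistent φ b S :=
      fun S hS F hF => ⟨a, fun σ hσ => by
        rcases hS (hF hσ) with rfl | rfl
        exacts [ha x (by simp), ha y (by simp)]⟩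
    rcases hf.adj x y hadj with h | h
    · exact hb.not_consistent_pair hm h (hpair _ subset_rfl)
    · exact hb.not_consistent_pair hm h (hpair _ (Set.pair_comm _ _).subset)
  · rcases F.eq_empty_or_nonempty with rfl | hne
    -- The empty set is no comb; here any tuple of the nonempty model works.
    · exact ⟨fun _ => Classical.arbitrary M, by simp⟩
    · obtain ⟨a, ha⟩ := hb.consistent _ (hf.indep F hne (hind.mono hF)) (F.image f) (by simp)
      exact ⟨a, fun i hi => ha _ (Finset.mem_image_of_mem f hi)⟩

/-! ### Transfer of consistency by Łoś's theorem. -/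

section Ultraproduct

open Filter

variable {I : Type*} {M : I → Type*} [∀ i, ℒ.Structure (M i)] [∀ i, Nonempty (M i)]
  {U : Ultrafilter I}

theorem realize_sumElim_ultraproduct {a : α → ∀ i, M i} {b : β → ∀ i, M i} :
    φ.Realize (Sum.elim (fun x => ((a x : ∀ i, M i) : (U : Filter I).Product M))
      (fun y => ((b y : ∀ i, M i) : (U : Filter I).Product M))) ↔
    ∀ᶠ i in U, φ.Realize (Sum.elim (fun x => a x i) (fun y => b y i)) := by
  have h := Ultraproduct.realize_formula_cast (u := U) φ (Sum.elim a b)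
  have h₁ : (fun z => ((Sum.elim a b z : ∀ i, M i) : (U : Filter I).Product M)) =
      Sum.elim (fun x => ((a x : ∀ i, M i) : (U : Filter I).Product M))
        (fun y => ((b y : ∀ i, M i) : (U : Filter I).Product M)) := by
    ext z; cases z <;> rfl
  have h₂ : ∀ i, (fun z => Sum.elim a b z i) = Sum.elim (fun x => a x i) (fun y => b y i) := by
    intro i; ext z; cases z <;> rfl
  simp only [h₂] at h
  rwa [h₁] at h

variable {ι : Type*} {J : I → Type*} (r : ∀ i, ι → J i) (b : ∀ i, J i → β → M i)

/-- The parameters in an ultraproduct given by the parameters `b i (r i j)` in the factors. -/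
def ultraParam (U : Ultrafilter I) (j : ι) (y : β) : (U : Filter I).Product M :=
  ((fun i => b i (r i j) y : ∀ i, M i) : (U : Filter I).Product M)

theorem consistent_ultraParam {C : Set ι} (h : ∀ᶠ i in U, Consistent φ (b i) (r i '' C)) :
    Consistent φ (ultraParam r b U) C := by
  classical
  intro F hF
  have hex : ∀ i, ∃ a : α → M i, Consistent φ (b i) (r i '' C) →
      ∀ j ∈ F, φ.Realize (Sum.elim a (b i (r i j))) := by
    intro i
    by_cases hi : Consistent φ (b i) (r i '' C)
    · obtain ⟨a, ha⟩ := hi (F.image (r i)) (by simpa using Set.image_mono hF)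
      exact ⟨a, fun _ j hj => ha _ (Finset.mem_image_of_mem _ hj)⟩
    -- A default witness for the factors where consistency fails; by `h` they form a `U`-null set.
    · exact ⟨fun _ => Classical.arbitrary _, fun h => absurd h hi⟩
  choose a ha using hex
  exact ⟨fun x => ((fun i => a i x : ∀ i, M i) : (U : Filter I).Product M), fun j hj =>
    realize_sumElim_ultraproduct.2 (h.mono fun i hi => ha i hi j hj)⟩

/-- Lift a realization to representatives; each of the finitely many instances holds on a `U`-large
set, hence all do together. Used contrapositively, it carries inconsistency to the ultraproduct. -/
theorem eventually_consistent_of_ultraParam {F : Finset ι}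
    (h : Consistent φ (ultraParam r b U) (F : Set ι)) :
    ∀ᶠ i in U, Consistent φ (b i) (r i '' (F : Set ι)) := by
  obtain ⟨a, ha⟩ := h F subset_rfl
  choose a' ha' using fun x => Quotient.exists_rep (a x)
  obtain rfl : (fun x => ((a' x : ∀ i, M i) : (U : Filter I).Product M)) = a := funext ha'
  have h' : ∀ᶠ i in U, ∀ j ∈ F, φ.Realize (Sum.elim (fun x => a' x i) (b i (r i j))) :=
    (Finset.eventually_all F).2 fun j hj => realize_sumElim_ultraproduct.1 (ha j hj)
  filter_upwards [h'] with i hi F' hF'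
  refine ⟨fun x => a' x i, fun j hj => ?_⟩
  obtain ⟨k, hk, rfl⟩ := hF' hj
  exact hi k hk

end Ultraproduct

/-! ### From all finite depths to depth `ω`. -/

section Depth

open Filter

variable {M : ℕ → Type*} [∀ d, ℒ.Structure (M d)] [∀ d, Nonempty (M d)]
  {b : ∀ d, (Fin d → Two2) → β → M d} {k : ℕ} {m n : ℕ∞}

theorem isWeave_ultraParam (h : ∀ d, IsWeave k m n (Fin d) φ (b d)) :
    IsWeave k m n ℕ φ (ultraParam truncate b (hyperfilter ℕ)) where
  inconsistent C hC F hF hk hcons := by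
    classical
    have hle := Nat.hyperfilter_le_atTop
    -- One depth `d` where the truncated family is consistent, the comb survives and `F` stays
    -- injective already contradicts the weave there.
    obtain ⟨d, hd₁, hd₂, hd₃⟩ := ((eventually_consistent_of_ultraParam _ _ hcons).and
      ((hC.eventually_truncate.filter_mono hle).and
        ((eventually_truncate_injOn F).filter_mono hle))).exists
    refine (h d).inconsistent _ hd₂ (F.image (truncate d)) ?_ ?_ (by simpa using hd₁)
    · simpa using Set.image_mono hF
    · rw [Finset.card_image_of_injOn hd₃, hk]
  consistent _ hC := consistent_ultraParam _ _ <|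
    (hC.eventually_truncate.filter_mono Nat.hyperfilter_le_atTop).mono fun d hd =>
      (h d).consistent _ hd

theorem isStrongWeave_ultraParam (h : ∀ d, IsStrongWeave k m n (Fin d) φ (b d)) :
    IsStrongWeave k m n ℕ φ (ultraParam truncate b (hyperfilter ℕ)) where
  toIsWeave := isWeave_ultraParam fun d => (h d).toIsWeave
  wide_consistent _ hC := consistent_ultraParam _ _ <|
    (hC.eventually_truncate.filter_mono Nat.hyperfilter_le_atTop).mono fun d hd =>
      (h d).wide_consistent _ hd

end Depth

/-- An ultraproduct of models of `T`, as a model of `T`. -/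
noncomputable def ultraModel (M : ℕ → Theory.ModelType.{u, v, max u v} T) (U : Ultrafilter ℕ) :
    Theory.ModelType.{u, v, max u v} T :=
  have : (U : Filter ℕ).Product (fun d => (M d : Type max u v)) ⊨ T :=
    ⟨fun _ hψ => (Ultraproduct.sentence_realize _).2
      (.of_forall fun d => (M d).is_model.realize_of_mem _ hψ)⟩
  Theory.ModelType.of T ((U : Filter ℕ).Product (fun d => (M d : Type max u v)))

theorem hasWeave_nat_of_forall_fin {k : ℕ} {m n : ℕ∞} (h : ∀ d, HasWeave T φ k m n (Fin d)) :
    HasWeave T φ k m n ℕ := by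
  choose M b hb using h
  exact ⟨ultraModel M (Filter.hyperfilter ℕ), ultraParam truncate b _, isWeave_ultraParam hb⟩

theorem hasStrongWeave_nat_of_forall_fin {k : ℕ} {m n : ℕ∞}
    (h : ∀ d, HasStrongWeave T φ k m n (Fin d)) : HasStrongWeave T φ k m n ℕ := by
  choose M b hb using h
  exact ⟨ultraModel M (Filter.hyperfilter ℕ), ultraParam truncate b _,
    isStrongWeave_ultraParam hb⟩

end Models

end Weave

theorem mainTheorem5 {ℒ : FirstOrder.Language.{u, v}} {α β : Type*}
    (T : ℒ.Theory) (φ : ℒ.Formula (α ⊕ β)) :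
    List.TFAE [
      Weave.AdmitsCographPatterns T φ,
      Weave.HasWeave T φ 2 ⊤ ⊤ ℕ,
      Weave.HasStrongWeave T φ 2 ⊤ ⊤ ℕ,
      Weave.HasWeave T φ 2 1 ⊤ ℕ,
      Weave.HasStrongWeave T φ 2 1 ⊤ ℕ,
      ∀ d : ℕ, Weave.HasWeave T φ 2 ⊤ ⊤ (Fin d),
      ∀ d : ℕ, Weave.HasStrongWeave T φ 2 ⊤ ⊤ (Fin d),
      ∀ d : ℕ, Weave.HasWeave T φ 2 1 ⊤ (Fin d),
      ∀ d : ℕ, Weave.HasStrongWeave T φ 2 1 ⊤ (Fin d)] := by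
  -- Item 7 is the strongest finite-depth version and item 4 the weakest at depth `ω`; every other
  -- weave version lies between them, and 4 returns to 1.
  tfae_have 1 → 7 := fun h d => h.hasStrongWeave ⊤ ⊤ d
  tfae_have 7 → 3 := Weave.hasStrongWeave_nat_of_forall_fin
  tfae_have 3 → 2 := fun h => h.hasWeave
  tfae_have 2 → 4 := fun h => h.mono le_top
  tfae_have 3 → 5 := fun h => h.mono le_top
  tfae_have 5 → 4 := fun h => h.hasWeave
  tfae_have 4 → 1 := fun h => h.admitsCographPatterns le_rfl
  tfae_have 7 → 6 := fun h d => (h d).hasWeave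
  tfae_have 6 → 8 := fun h d => (h d).mono le_top
  tfae_have 7 → 9 := fun h d => (h d).mono le_top
  tfae_have 9 → 8 := fun h d => (h d).hasWeave
  tfae_have 8 → 4 := Weave.hasWeave_nat_of_forall_fin
  tfae_finish
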